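/- Let $\mathcal{U}$ be a standard Borel space with a $\sigma$-finite reference measure $\theta$, let $\mu \ll \theta$ be a $\sigma$-finite measure on $\mathcal{U}$, and let $P, Q \ll \mu$ be probability measures on $\mathcal{U}$. Write $\mu(u), p(u), q(u)$ for the densities (Radon–Nikodym derivatives) of $\mu, P, Q$ with respect to $\theta$. Let $\{(U_i, T_i)\}_{i \in \mathbb{N}}$ be the points of a Poisson point process on $\mathcal{U} \times \mathbb{R}_{\ge 0}$ with intensity measure $\mu \times \lambda$, where $\lambda$ is Lebesgue measure on $\mathbb{R}_{\ge 0}$. Let $K \ge 1$ and let $(Z_i)_{i\in\mathbb{N}}$ be i.i.d. labels, uniformly distributed on $\{1, \ldots, K\}$ and independent of $\{(U_i,T_i)\}_{i \in \mathbb{N}}$. Select the indices $$K_p = \operatorname*{arg\,min}_{i} \frac{T_i\, \mu(U_i)}{p(U_i)}, \qquad K_{qk} = \operatorname*{arg\,min}_{i \,:\, Z_i = k} \frac{T_i\, \mu(U_i)}{q(U_i)} \quad (k = 1, \ldots, K),$$ where a quotient with positive numerator and zero denominator is $+\infty$, and put $U_p = U_{K_p}$ and $U_{qk} = U_{K_{qk}}$.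 Then, almost surely, all these minimizers exist and are unique; moreover, when the indices are chosen measurably on the exceptional null set (as the least minimizer, or the first index if there is none), $U_p$ is a random variable, $\{U_p \notin \{U_{qk}\}_{k=1}^K\}$ is an event, and almost surely $$\Pr\bigl[\, U_p \notin \{U_{qk}\}_{k=1}^{K} \,\big|\, U_p \,\bigr] \le 1 - \Bigl( 1 + \frac{p(U_p)}{K\, q(U_p)} \Bigr)^{-1},$$ where the right-hand side is read as $1$ if $q(U_p) = 0 < p(U_p)$. -/

import Mathlib

open MeasureTheory ProbabilityTheory
open scoped NNReal ENNReal

noncomputable section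

namespace ListPML

/-- The Poisson law with mean `r ∈ [0, ∞]`, as a measure on `ℕ ∪ {∞}`; the Poisson law with
infinite mean is the point mass at `∞`. -/
def poissonLaw (r : ℝ≥0∞) : Measure ℕ∞ :=
  if r = ∞ then Measure.dirac ⊤ else (poissonMeasure r.toNNReal).map (fun n : ℕ => (n : ℕ∞))

/-- The number of points, counted with multiplicity, of the sequence of random points `X` that
lie in the set `B`. -/
def pointCount {Ω S : Type*} (X : ℕ → Ω → S) (B : Set S) (ω : Ω) : ℕ∞ :=
  {i : ℕ | X i ω ∈ B}.encard

/-- The random points `X 0, X 1, …` are the points of a Poisson point process with intensity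
measure `ν`: the number of points in a measurable set `B` has the Poisson law with mean `ν B`, and
the numbers of points in pairwise disjoint measurable sets are independent. -/
structure IsPoissonProcess {Ω S : Type*} [MeasurableSpace Ω] [MeasurableSpace S]
    (X : ℕ → Ω → S) (ν : Measure S) (Pr : Measure Ω) : Prop where
  measurable_point : ∀ i, Measurable (X i)
  hasLaw_count : ∀ B : Set S, MeasurableSet B → HasLaw (pointCount X B) (poissonLaw (ν B)) Pr
  indep_count : ∀ (n : ℕ) (B : Fin n → Set S), (∀ j, MeasurableSet (B j)) →
    Pairwise (fun j l => Disjoint (B j) (B l)) → iIndepFun (fun j => pointCount X (B j)) Pr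

/-- The labels `Z 0, Z 1, …` are independent, uniformly distributed on a set of `K` labels, and
independent of the sequence of random points `X`. -/
structure IsUniformLabelling {Ω S : Type*} [MeasurableSpace Ω] [MeasurableSpace S] {K : ℕ}
    (Z : ℕ → Ω → Fin K) (X : ℕ → Ω → S) (Pr : Measure Ω) : Prop where
  measurable_label : ∀ i, Measurable (Z i)
  uniform : ∀ i k, Pr {ω | Z i ω = k} = (K : ℝ≥0∞)⁻¹
  iIndep : iIndepFun Z Pr
  indep_points : IndepFun (fun ω (i : ℕ) => X i ω) (fun ω (i : ℕ) => Z i ω) Pr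

/-- Lebesgue measure on `[0, ∞)`. -/
def lebesgueNNReal : Measure ℝ≥0 :=
  Measure.comap (fun t : ℝ≥0 => (t : ℝ)) volume

/-- The score `t μ(u) / p(u)` of a point `(u, t)`, where `μ(u)` and `p(u)` are the densities of
`μ` and `P` with respect to the reference measure `θ`. It is `∞` if `p(u) = 0 < t μ(u)`. -/
def score {𝓤 : Type*} [MeasurableSpace 𝓤] (θ μ P : Measure 𝓤) (u : 𝓤) (t : ℝ≥0) : ℝ≥0∞ :=
  (t : ℝ≥0∞) * μ.rnDeriv θ u / P.rnDeriv θ u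

/-- The index `i` minimizes `s` over the set of indices `I`. -/
def IsArgmin (I : Set ℕ) (s : ℕ → ℝ≥0∞) (i : ℕ) : Prop :=
  i ∈ I ∧ ∀ j ∈ I, s i ≤ s j

/-- The index minimizing `s` over `I` (the least one in case of ties, and `0` if there is no
minimizer). -/
def argmin (I : Set ℕ) (s : ℕ → ℝ≥0∞) : ℕ :=
  sInf {i | IsArgmin I s i}

section Selection

variable {Ω 𝓤 : Type*} [MeasurableSpace 𝓤] {K : ℕ}

/-- The point `U_p` selected with `P` among all points. -/
def selected (θ μ P : Measure 𝓤) (U : ℕ → Ω → 𝓤) (T : ℕ → Ω → ℝ≥0) (ω : Ω) : 𝓤 :=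
  U (argmin Set.univ (fun i => score θ μ P (U i ω) (T i ω))) ω

/-- The point `U_{qk}` selected with `Q` among the points labelled `k`. -/
def selectedLabel (θ μ Q : Measure 𝓤) (U : ℕ → Ω → 𝓤) (T : ℕ → Ω → ℝ≥0) (Z : ℕ → Ω → Fin K)
    (k : Fin K) (ω : Ω) : 𝓤 :=
  U (argmin {i | Z i ω = k} (fun i => score θ μ Q (U i ω) (T i ω))) ω

/-- The event that `U_p` differs from all of `U_{q1}, …, U_{qK}`. -/
def mismatch (θ μ P Q : Measure 𝓤) (U : ℕ → Ω → 𝓤) (T : ℕ → Ω → ℝ≥0) (Z : ℕ → Ω → Fin K) :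
    Set Ω :=
  {ω | selected θ μ P U T ω ∉ Set.range (fun k => selectedLabel θ μ Q U T Z k ω)}

end Selection

/-- The number `1 - (1 + p(u) / (K q(u)))⁻¹`, with `p`, `q` the densities of `P`, `Q` with respect
to `θ`; it is computed in `[0, ∞]`, so that it is `1` if `q(u) = 0 < p(u)`. -/
def mismatchBound {𝓤 : Type*} [MeasurableSpace 𝓤] (K : ℕ) (θ P Q : Measure 𝓤) (u : 𝓤) : ℝ :=
  (1 - (1 + P.rnDeriv θ u / ((K : ℝ≥0∞) * Q.rnDeriv θ u))⁻¹).toReal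

end ListPML

end

/-! Write `h₁` and `h₂` for the scores with respect to `P` and `Q`. The points with `h₁ < t` and
location in `A` have intensity `t * P A`. So, heuristically, the smallest `h₁` has density `exp
(-t)`, and its location `u` is independent of it with law `P`. Since `h₂ = (p/q) h₁` at a given
location, put `r = p(u)/q(u)`: the point `(u, ·)` with `h₁ = t` also wins the `Q`-race of its own
label unless some point with that label has `h₂ < t r`. Such competitors are a thinning by `1/K` of
a process of mass at most `t r`, so none occurs with probability at least `exp (-t r / K)`.
Integrating `exp (-t (1 + r/K))` over `t` gives the match probability `(1 + r/K)⁻¹`.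

The integral over `t` is replaced by thin slices of `h₁`-values. `le_measure_isolated` bounds the
probability that one slice holds the common winner, and `le_measure_commonMinimizer` sums the slices
(a geometric series) and lets their width tend to `0`. Applied with equal scores it yields the law
of `U_p` (`measure_selected`); applied to `P` and `Q` on a set where `p ≤ c q` it yields
`le_measure_match`.

Testing the conditional probability on events `U_p ∈ A` with `A ⊆ {p ≤ c q}` gives an almost sure
bound for each fixed `c` (`ae_condProb_mismatch_le`). Letting rational `c` decrease to `p/q` at
`U_p` finishes the proof. -/

namespace ListPML

/-! ### Poisson laws and measurability of counts. -/

theorem poissonLaw_singleton {r : ℝ≥0∞} (hr : r ≠ ∞) (n : ℕ) :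
    poissonLaw r {(n : ℕ∞)} =
      ENNReal.ofReal (Real.exp (-r.toReal) * r.toReal ^ n / n.factorial) := by
  have : (fun n : ℕ => (n : ℕ∞)) ⁻¹' {(n : ℕ∞)} = {n} := by ext m; simp
  rw [poissonLaw, if_neg hr, Measure.map_apply .of_discrete (measurableSet_singleton _), this,
    poissonMeasure_singleton]
  rfl

theorem poissonLaw_singleton_top {r : ℝ≥0∞} (hr : r ≠ ∞) : poissonLaw r {⊤} = 0 := by
  have : (fun n : ℕ => (n : ℕ∞)) ⁻¹' {⊤} = ∅ := by ext m; simp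
  rw [poissonLaw, if_neg hr, Measure.map_apply .of_discrete (measurableSet_singleton _), this,
    measure_empty]

theorem isProbabilityMeasure_poissonLaw (r : ℝ≥0∞) : IsProbabilityMeasure (poissonLaw r) := by
  rw [poissonLaw]
  split_ifs
  · infer_instance
  · exact Measure.isProbabilityMeasure_map .of_discrete

/-- From `exp (-r) ≥ 1 - r`, one gets `1 - exp (-r) * (1 + r) ≤ 1 - (1 - r) * (1 + r) = r ^ 2`. The
quadratic order is what excludes ties of scores. -/
theorem poissonLaw_two_le {r : ℝ≥0∞} (hr : r ≠ ∞) : poissonLaw r {m | 2 ≤ m} ≤ r ^ 2 := by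
  have := isProbabilityMeasure_poissonLaw r
  have hset : {m : ℕ∞ | 2 ≤ m} = ({((0 : ℕ) : ℕ∞)} ∪ {((1 : ℕ) : ℕ∞)})ᶜ := by
    ext m
    induction m with
    | top => simp
    | coe m => norm_cast; simp; omega
  rw [hset, prob_compl_eq_one_sub (.of_discrete), measure_union (by simp) (.of_discrete),
    poissonLaw_singleton hr, poissonLaw_singleton hr, ← ENNReal.ofReal_add (by positivity)
    (by positivity), ← ENNReal.ofReal_one, ← ENNReal.ofReal_sub _ (by positivity)]
  refine (ENNReal.ofReal_le_ofReal (q := r.toReal ^ 2) ?_).trans_eq ?_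
  · have h0 : 0 ≤ r.toReal := ENNReal.toReal_nonneg
    have h1 := Real.one_sub_le_exp_neg r.toReal
    simp only [pow_zero, mul_one, Nat.factorial_zero, Nat.cast_one, div_one, pow_one,
      Nat.factorial_one]
    nlinarith
  · rw [ENNReal.ofReal_pow ENNReal.toReal_nonneg, ENNReal.ofReal_toReal hr]

theorem measurable_encard_index {S : Type*} [MeasurableSpace S] {B : Set S}
    (hB : MeasurableSet B) : Measurable (fun x : ℕ → S => {i : ℕ | x i ∈ B}.encard) := by
  have hle : ∀ n : ℕ, MeasurableSet {x : ℕ → S | (n : ℕ∞) ≤ {i : ℕ | x i ∈ B}.encard} := by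
    intro n
    -- At least `n` hits means that some `n`-element set of indices consists of hits, and there are
    -- only countably many finite sets of indices.
    have : {x : ℕ → S | (n : ℕ∞) ≤ {i : ℕ | x i ∈ B}.encard} =
        ⋃ F : Finset ℕ, ⋃ _ : F.card = n, ⋂ i ∈ F, {x | x i ∈ B} := by
      ext x
      simp only [Set.mem_ofPred_eq, Set.mem_iUnion, Set.mem_iInter, exists_prop]
      constructor
      · intro h
        obtain ⟨t, ht, htn⟩ := Set.exists_subset_encard_eq h
        have hfin : t.Finite := Set.finite_of_encard_eq_coe htn
        refine ⟨hfin.toFinset, ?_, fun i hi => ht (by simpa using hi)⟩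
        rw [hfin.encard_eq_coe_toFinset_card] at htn
        exact_mod_cast htn
      · rintro ⟨F, rfl, hF⟩
        rw [← Set.encard_coe_eq_coe_finsetCard]
        exact Set.encard_le_encard fun i hi => hF i hi
    rw [this]
    exact .iUnion fun F => .iUnion fun _ => .biInter (Set.to_countable _) fun i _ =>
      measurable_pi_apply i hB
  refine measurable_to_countable' fun m => ?_
  induction m with
  | top =>
    convert MeasurableSet.iInter hle using 1
    ext x
    simp only [Set.mem_preimage, Set.mem_singleton_iff, Set.mem_iInter, Set.mem_ofPred_eq]
    exact ENat.eq_top_iff_forall_ge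
  | coe m =>
    convert (hle m).diff (hle (m + 1)) using 1
    ext x
    simp only [Set.mem_preimage, Set.mem_singleton_iff, Set.mem_sdiff, Set.mem_ofPred_eq, not_le]
    generalize {i : ℕ | x i ∈ B}.encard = y
    induction y with
    | top => simp
    | coe y => norm_cast; omega

/-! ### Finiteness, infinity and absence of ties for Poisson points. -/

namespace IsPoissonProcess

variable {Ω S : Type*} [MeasurableSpace Ω] [MeasurableSpace S] {X : ℕ → Ω → S} {ν : Measure S}
  {Pr : Measure Ω}

theorem measurable_points (hX : IsPoissonProcess X ν Pr) :
    Measurable (fun ω (i : ℕ) => X i ω) :=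
  measurable_pi_lambda _ hX.measurable_point

theorem measurable_pointCount (hX : IsPoissonProcess X ν Pr) {B : Set S}
    (hB : MeasurableSet B) : Measurable (pointCount X B) :=
  (measurable_encard_index hB).comp hX.measurable_points

theorem measure_pointCount (hX : IsPoissonProcess X ν Pr) {B : Set S} (hB : MeasurableSet B)
    (s : Set ℕ∞) : Pr {ω | pointCount X B ω ∈ s} = poissonLaw (ν B) s :=
  (hX.hasLaw_count B hB).measure_eq (p := (· ∈ s)) .of_discrete

theorem ae_finite (hX : IsPoissonProcess X ν Pr) {B : Set S} (hB : MeasurableSet B)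
    (hν : ν B ≠ ∞) : ∀ᵐ ω ∂Pr, {i | X i ω ∈ B}.Finite := by
  have := hX.measure_pointCount hB {⊤}
  rw [poissonLaw_singleton_top hν] at this
  filter_upwards [measure_eq_zero_iff_ae_notMem.1 this] with ω hω
  exact Set.encard_ne_top_iff.1 hω

theorem ae_infinite (hX : IsPoissonProcess X ν Pr) {B : Set S} (hB : MeasurableSet B)
    (hν : ν B = ∞) : ∀ᵐ ω ∂Pr, {i | X i ω ∈ B}.Infinite := by
  have := hX.measure_pointCount hB {⊤}ᶜ
  rw [poissonLaw, if_pos hν, Measure.dirac_apply' _ .of_discrete] at this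
  filter_upwards [measure_eq_zero_iff_ae_notMem.1 (this.trans (by simp))] with ω hω
  simpa [pointCount] using hω

theorem measure_two_le (hX : IsPoissonProcess X ν Pr) {B : Set S} (hB : MeasurableSet B)
    (hν : ν B ≠ ∞) : Pr {ω | 2 ≤ pointCount X B ω} ≤ ν B ^ 2 :=
  (hX.measure_pointCount hB {m | 2 ≤ m}).trans_le (poissonLaw_two_le hν)

/-- Almost surely, no two points have the same finite value of `h`. -/
theorem ae_ne_of_lt_top (hX : IsPoissonProcess X ν Pr) {h : S → ℝ≥0∞} (hh : Measurable h)
    (hν : ∀ s d : ℝ≥0, ν {x | (s : ℝ≥0∞) ≤ h x ∧ h x < s + d} ≤ d) :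
    ∀ᵐ ω ∂Pr, ∀ i j, i ≠ j → h (X i ω) < ∞ → h (X i ω) ≠ h (X j ω) := by
  let tie (M : ℕ) : Set Ω := {ω | ∃ i j, i ≠ j ∧ h (X i ω) < M ∧ h (X i ω) = h (X j ω)}
  have htie : ∀ M, Pr (tie M) = 0 := by
    intro M
    -- Cut `[0, M)` into `M * (n + 1)` slices of width `d = 1 / (n + 1)`. A tie puts two points in
    -- one slice, which has probability at most `d ^ 2`; the union bound gives `M * d`.
    have hbound : ∀ n : ℕ, Pr (tie M) ≤ M * ((n : ℝ≥0∞) + 1)⁻¹ := by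
      intro n
      let d : ℝ≥0 := ((n : ℝ≥0) + 1)⁻¹
      have hd : (d : ℝ≥0∞) = ((n : ℝ≥0∞) + 1)⁻¹ := by
        simp only [d]
        rw [ENNReal.coe_inv (by positivity)]; simp
      have hd1 : d * (n + 1) = 1 := inv_mul_cancel₀ (by positivity)
      let B (k : ℕ) : Set S :=
        {x | ((k * d : ℝ≥0) : ℝ≥0∞) ≤ h x ∧ h x < (k * d : ℝ≥0) + d}
      have hB : ∀ k, MeasurableSet (B k) := fun k =>
        (measurableSet_le measurable_const hh).inter (measurableSet_lt hh measurable_const)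
      have hsub : tie M ⊆ ⋃ k ∈ Finset.range (M * (n + 1)), {ω | 2 ≤ pointCount X (B k) ω} := by
        rintro ω ⟨i, j, hij, hlt, heq⟩
        lift h (X i ω) to ℝ≥0 using hlt.ne_top with t ht
        have htM : t < M := by exact_mod_cast hlt
        let k := ⌊t * (n + 1)⌋₊
        have hk1 : (k : ℝ≥0) ≤ t * (n + 1) := Nat.floor_le (zero_le)
        have hk2 : t * (n + 1) < (k : ℝ≥0) + 1 := Nat.lt_floor_add_one _
        have hdpos : 0 < d := by positivity
        have hmem : ∀ l, h (X l ω) = t → X l ω ∈ B k := by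
          intro l hl
          have h1 : k * d ≤ t := by
            calc k * d ≤ t * (n + 1) * d := by gcongr
              _ = t := by rw [mul_assoc, mul_comm _ d, hd1, mul_one]
          have h2 : t < k * d + d := by
            calc t = t * (n + 1) * d := by rw [mul_assoc, mul_comm _ d, hd1, mul_one]
              _ < (k + 1) * d := by gcongr
              _ = k * d + d := by ring
          simp only [B, Set.mem_ofPred_eq, hl]
          exact_mod_cast And.intro h1 h2
        simp only [Set.mem_iUnion, Finset.mem_range, exists_prop]
        refine ⟨k, ?_, ?_⟩
        · rw [Nat.floor_lt (zero_le)]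
          push_cast
          gcongr
        · rw [Set.mem_ofPred_eq, pointCount, ← Set.encard_pair hij]
          refine Set.encard_le_encard ?_
          rintro l (rfl | rfl)
          · exact hmem _ ht.symm
          · exact hmem _ heq.symm
      calc Pr (tie M) ≤ ∑ k ∈ Finset.range (M * (n + 1)), Pr {ω | 2 ≤ pointCount X (B k) ω} :=
            (measure_mono hsub).trans (measure_biUnion_finset_le _ _)
        _ ≤ ∑ k ∈ Finset.range (M * (n + 1)), (d : ℝ≥0∞) ^ 2 := by
            refine Finset.sum_le_sum fun k _ => ?_
            have hle : ν (B k) ≤ d := hν (k * d) d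
            exact (hX.measure_two_le (hB k) (ne_top_of_le_ne_top (by simp) hle)).trans (by gcongr)
        _ = M * d * ((d * (n + 1) : ℝ≥0) : ℝ≥0∞) := by
            rw [Finset.sum_const, Finset.card_range, nsmul_eq_mul]; push_cast; ring
        _ = M * ((n : ℝ≥0∞) + 1)⁻¹ := by rw [hd1, hd]; simp
    refine le_antisymm (ge_of_tendsto' (x := Filter.atTop) ?_ hbound) (zero_le)
    have h0 : Filter.Tendsto (fun n : ℕ => ((n : ℝ≥0∞) + 1)⁻¹) Filter.atTop (nhds 0) := by
      have := (Filter.tendsto_add_atTop_iff_nat 1).2 ENNReal.tendsto_inv_nat_nhds_zero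
      simpa using this
    simpa using ENNReal.Tendsto.const_mul h0 (Or.inr (ENNReal.natCast_ne_top M))
  filter_upwards [ae_all_iff.2 fun M => measure_eq_zero_iff_ae_notMem.1 (htie M)]
    with ω hω i j hij hlt heq
  obtain ⟨M, hM⟩ := ENNReal.exists_nat_gt hlt.ne
  exact hω M ⟨i, j, hij, hM, heq⟩

end IsPoissonProcess

/-! ### Independent uniform labels. -/

theorem measure_eq_lintegral_of_indepFun {Ω α β : Type*} [MeasurableSpace Ω] [MeasurableSpace α]
    [MeasurableSpace β] {Pr : Measure Ω} [IsProbabilityMeasure Pr] {X : Ω → α} {Z : Ω → β}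
    (hX : Measurable X) (hZ : Measurable Z) (h : IndepFun X Z Pr) {E : Set (α × β)}
    (hE : MeasurableSet E) :
    Pr {ω | (X ω, Z ω) ∈ E} = ∫⁻ ω, Pr {ω' | (X ω, Z ω') ∈ E} ∂Pr := by
  have h1 : Pr {ω | (X ω, Z ω) ∈ E} = Pr.map (fun ω => (X ω, Z ω)) E :=
    (Measure.map_apply (hX.prodMk hZ) hE).symm
  rw [h1, h.map_prod_eq_prod_map_map hX.aemeasurable hZ.aemeasurable, Measure.prod_apply hE,
    lintegral_map (measurable_measure_prodMk_left hE) hX]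
  exact lintegral_congr fun ω => Measure.map_apply hZ (measurable_prodMk_left hE)

namespace IsUniformLabelling

variable {Ω S : Type*} [MeasurableSpace Ω] [MeasurableSpace S] {K : ℕ} {Z : ℕ → Ω → Fin K}
  {X : ℕ → Ω → S} {Pr : Measure Ω}

theorem measurable_labels (hZ : IsUniformLabelling Z X Pr) :
    Measurable (fun ω (i : ℕ) => Z i ω) :=
  measurable_pi_lambda _ hZ.measurable_label

variable [IsProbabilityMeasure Pr]

theorem measure_ne (hZ : IsUniformLabelling Z X Pr) (i : ℕ) (k : Fin K) :
    Pr (Z i ⁻¹' {k}ᶜ) = 1 - (K : ℝ≥0∞)⁻¹ := by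
  rw [Set.preimage_compl, prob_compl_eq_one_sub (hZ.measurable_label i (measurableSet_singleton k))]
  exact congrArg _ (hZ.uniform i k)

theorem measure_forall_ne (hZ : IsUniformLabelling Z X Pr) (I : Finset ℕ) (k : Fin K) :
    Pr {ω | ∀ i ∈ I, Z i ω ≠ k} = (1 - (K : ℝ≥0∞)⁻¹) ^ I.card := by
  have := hZ.iIndep.measure_inter_preimage_eq_mul I (sets := fun _ => {k}ᶜ)
    fun _ _ => .of_discrete
  simp only [hZ.measure_ne, Finset.prod_const] at this
  rw [← this]
  congr 1
  ext ω
  simp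

/-- Split by the value `k` of the label at `i₀`: by independence each of the `K` values contributes
`K⁻¹ * (1 - K⁻¹) ^ I.card`. -/
theorem measure_forall_ne_label (hZ : IsUniformLabelling Z X Pr) (hK : 1 ≤ K) {I : Finset ℕ}
    {i₀ : ℕ} (hi₀ : i₀ ∉ I) :
    Pr {ω | ∀ i ∈ I, Z i₀ ω ≠ Z i ω} = (1 - (K : ℝ≥0∞)⁻¹) ^ I.card := by
  have hpart : ∀ k, Pr ({ω | ∀ i ∈ I, Z i₀ ω ≠ Z i ω} ∩ Z i₀ ⁻¹' {k}) =
      (K : ℝ≥0∞)⁻¹ * (1 - (K : ℝ≥0∞)⁻¹) ^ I.card := by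
    intro k
    have := hZ.iIndep.measure_inter_preimage_eq_mul (insert i₀ I)
      (sets := fun i => if i = i₀ then {k} else {k}ᶜ) fun _ _ => .of_discrete
    rw [Finset.prod_insert hi₀, if_pos rfl, Finset.prod_congr rfl (g := fun _ =>
      1 - (K : ℝ≥0∞)⁻¹) (fun i hi => by
        rw [if_neg (ne_of_mem_of_not_mem hi hi₀), hZ.measure_ne]), Finset.prod_const] at this
    rw [show Pr (Z i₀ ⁻¹' {k}) = (K : ℝ≥0∞)⁻¹ from hZ.uniform i₀ k] at this
    refine Eq.trans ?_ this
    congr 1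
    ext ω
    simp only [Set.mem_inter_iff, Set.mem_ofPred_eq, Set.mem_preimage, Set.mem_singleton_iff,
      Finset.mem_insert, Set.iInter_iInter_eq_or_left, if_true, Set.mem_iInter]
    constructor
    · rintro ⟨h, rfl⟩
      refine ⟨rfl, fun i hi => ?_⟩
      rw [if_neg (ne_of_mem_of_not_mem hi hi₀)]
      exact (h i hi).symm
    · rintro ⟨rfl, h⟩
      refine ⟨fun i hi => ?_, rfl⟩
      have := h i hi
      rw [if_neg (ne_of_mem_of_not_mem hi hi₀)] at this
      exact Ne.symm this
  have hsum := sum_measure_preimage_singleton (μ := Pr.restrict {ω | ∀ i ∈ I, Z i₀ ω ≠ Z i ω})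
    Finset.univ (f := Z i₀) fun k _ => hZ.measurable_label i₀ (measurableSet_singleton k)
  simp only [Measure.restrict_apply (hZ.measurable_label i₀ (measurableSet_singleton _)),
    Set.inter_comm (Z i₀ ⁻¹' _), hpart, Finset.sum_const, Finset.card_univ, Fintype.card_fin,
    Finset.coe_univ, Set.preimage_univ, Measure.restrict_apply_univ, nsmul_eq_mul] at hsum
  rw [← hsum, ← mul_assoc, ENNReal.mul_inv_cancel (by simp; omega) (by simp), one_mul]

/-- Almost surely, every label occurs among the points in a set that contains infinitely many
points. -/
theorem ae_exists_label (hZ : IsUniformLabelling Z X Pr) (hX : ∀ i, Measurable (X i))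
    {B : Set S} (hB : MeasurableSet B) (hinf : ∀ᵐ ω ∂Pr, {i | X i ω ∈ B}.Infinite) :
    ∀ᵐ ω ∂Pr, ∀ k, ∃ i, X i ω ∈ B ∧ Z i ω = k := by
  refine ae_all_iff.2 fun k => ?_
  let E : Set ((ℕ → S) × (ℕ → Fin K)) := {y | ∀ i, y.1 i ∈ B → y.2 i ≠ k}
  have hE : MeasurableSet E := by
    have : E = ⋂ i, ({y | y.1 i ∈ B}ᶜ ∪ {y | y.2 i ≠ k}) := by
      ext y; simp [E, imp_iff_not_or]
    rw [this]
    refine .iInter fun i => .union (.compl ?_) ?_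
    · exact ((measurable_pi_apply i).comp measurable_fst) hB
    · exact (measurableSet_eq_fun ((measurable_pi_apply i).comp measurable_snd)
        measurable_const).compl
  -- With the points frozen, label `k` must be avoided at infinitely many indices, hence at `n` of
  -- them for every `n`, and `(1 - K⁻¹) ^ n` tends to `0`.
  have hzero : Pr {ω | ((fun i => X i ω), fun i => Z i ω) ∈ E} = 0 := by
    rw [measure_eq_lintegral_of_indepFun (measurable_pi_lambda _ hX) hZ.measurable_labels
      hZ.indep_points hE, lintegral_eq_zero_iff' ]
    · filter_upwards [hinf] with ω hω
      have hbound : ∀ n : ℕ, Pr {ω' | ((fun i => X i ω), fun i => Z i ω') ∈ E} ≤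
          (1 - (K : ℝ≥0∞)⁻¹) ^ n := by
        intro n
        obtain ⟨I, hI, rfl⟩ := hω.exists_subset_card_eq n
        rw [← hZ.measure_forall_ne I k]
        exact measure_mono fun ω' h i hi => h i (hI hi)
      refine le_antisymm (ge_of_tendsto' (x := Filter.atTop) ?_ hbound) zero_le
      exact ENNReal.tendsto_pow_atTop_nhds_zero_of_lt_one
        (ENNReal.sub_lt_self (by simp) (by simp) (by simp))
    · exact ((measurable_measure_prodMk_left (ν := Pr.map (fun ω i => Z i ω)) hE).comp
        (measurable_pi_lambda (fun ω i => X i ω) hX)).aemeasurable.congr (.of_forall fun ω =>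
          Measure.map_apply hZ.measurable_labels (measurable_prodMk_left hE))
  filter_upwards [measure_eq_zero_iff_ae_notMem.1 hzero] with ω hω
  simpa [E] using hω

end IsUniformLabelling

/-! ### Thinning and isolated points. -/

theorem tsum_thinned_poisson {w κ : ℝ} (hw : 0 ≤ w) (hκ : κ ≤ 1) :
    ∑' n : ℕ, ENNReal.ofReal (1 - κ) ^ n * ENNReal.ofReal (Real.exp (-w) * w ^ n / n.factorial) =
      ENNReal.ofReal (Real.exp (-(κ * w))) := by
  have hκ' : 0 ≤ 1 - κ := by linarith
  have hs := (NormedSpace.expSeries_div_hasSum_exp ((1 - κ) * w)).mul_left (Real.exp (-w))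
  rw [← Real.exp_eq_exp_ℝ, ← Real.exp_add] at hs
  rw [show -(κ * w) = -w + (1 - κ) * w by ring, ← hs.tsum_eq,
    ENNReal.ofReal_tsum_of_nonneg (fun n => by positivity) hs.summable]
  refine tsum_congr fun n => ?_
  rw [← ENNReal.ofReal_pow hκ', ← ENNReal.ofReal_mul (by positivity)]
  congr 1
  rw [mul_pow]; ring

section Isolated

variable {Ω S : Type*} [MeasurableSpace Ω] [MeasurableSpace S] {K : ℕ} {Z : ℕ → Ω → Fin K}
  {X : ℕ → Ω → S} {Pr : Measure Ω}

/-- The event that `D` contains exactly one point, `W` contains none, and the points in `V` carry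
labels different from that of the point in `D`. -/
def isolated (X : ℕ → Ω → S) (Z : ℕ → Ω → Fin K) (D W V : Set S) : Set Ω :=
  {ω | pointCount X D ω = 1 ∧ pointCount X W ω = 0 ∧
    ∀ i j, X i ω ∈ D → X j ω ∈ V → Z i ω ≠ Z j ω}

theorem measurableSet_forall_label_ne (hX : ∀ i, Measurable (X i)) (hZ : ∀ i, Measurable (Z i))
    {D V : Set S} (hD : MeasurableSet D) (hV : MeasurableSet V) :
    MeasurableSet {ω | ∀ i j, X i ω ∈ D → X j ω ∈ V → Z i ω ≠ Z j ω} := by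
  have : {ω | ∀ i j, X i ω ∈ D → X j ω ∈ V → Z i ω ≠ Z j ω} =
      ⋂ i, ⋂ j, ((X i ⁻¹' D)ᶜ ∪ ((X j ⁻¹' V)ᶜ ∪ {ω | Z i ω = Z j ω}ᶜ)) := by
    ext ω; simp [imp_iff_not_or]
  rw [this]
  exact .iInter fun i => .iInter fun j => (hX i hD).compl.union
    ((hX j hV).compl.union (measurableSet_eq_fun (hZ i) (hZ j)).compl)

theorem IsPoissonProcess.measurableSet_isolated {ν : Measure S} (hX : IsPoissonProcess X ν Pr)
    (hZ : ∀ i, Measurable (Z i)) {D W V : Set S} (hD : MeasurableSet D) (hW : MeasurableSet W)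
    (hV : MeasurableSet V) : MeasurableSet (isolated X Z D W V) := by
  refine (hX.measurable_pointCount hD (measurableSet_singleton 1)).inter
    ((hX.measurable_pointCount hW (measurableSet_singleton 0)).inter ?_)
  exact measurableSet_forall_label_ne hX.measurable_point hZ hD hV

/-- Decompose by the number `n` of points in `V`. The three counts are independent since the sets
are disjoint, and given the points, the `n` labels in `V` all avoid the label in `D` with
probability `(1 - K⁻¹) ^ n`. Summing over `n` is evaluating a Poisson generating function, so `V`
counts only with mass `ν V / K`. -/
theorem le_measure_isolated {ν : Measure S} [IsProbabilityMeasure Pr]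
    (hX : IsPoissonProcess X ν Pr) (hZ : IsUniformLabelling Z X Pr) (hK : 1 ≤ K)
    {D W V : Set S} (hD : MeasurableSet D) (hW : MeasurableSet W) (hV : MeasurableSet V)
    (hDW : Disjoint D W) (hDV : Disjoint D V) (hWV : Disjoint W V)
    (hνD : ν D ≠ ∞) (hνW : ν W ≠ ∞) (hνV : ν V ≠ ∞) :
    ENNReal.ofReal ((ν D).toReal *
        Real.exp (-((ν D).toReal + (ν W).toReal + (ν V).toReal / K))) ≤
      Pr (isolated X Z D W V) := by
  have hKpos : (0 : ℝ) < K := by exact_mod_cast hK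
  have hq : (1 : ℝ≥0∞) - (K : ℝ≥0∞)⁻¹ = ENNReal.ofReal (1 - (K : ℝ)⁻¹) := by
    rw [ENNReal.ofReal_sub _ (by positivity), ENNReal.ofReal_inv_of_pos hKpos]; simp
  let F (n : ℕ) : Set Ω := {ω | pointCount X D ω = 1 ∧ pointCount X W ω = 0 ∧ pointCount X V ω = n}
  have hFm : ∀ n, MeasurableSet (F n) := fun n =>
    (hX.measurable_pointCount hD (measurableSet_singleton 1)).inter
      ((hX.measurable_pointCount hW (measurableSet_singleton 0)).inter
        (hX.measurable_pointCount hV (measurableSet_singleton (n : ℕ∞))))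
  have hF : ∀ n, Pr (F n) = poissonLaw (ν D) {1} * poissonLaw (ν W) {0} *
      poissonLaw (ν V) {(n : ℕ∞)} := by
    intro n
    have hind := hX.indep_count 3 ![D, W, V] (by intro j; fin_cases j <;> assumption) (by
      intro j l hjl
      fin_cases j <;> fin_cases l <;> simp_all [disjoint_comm])
    have := hind.measure_inter_preimage_eq_mul Finset.univ
      (sets := ![{1}, {0}, {(n : ℕ∞)}]) fun _ _ => .of_discrete
    rw [Fin.prod_univ_three] at this
    have h1 := hX.measure_pointCount hD {1}
    have h2 := hX.measure_pointCount hW {0}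
    have h3 := hX.measure_pointCount hV {(n : ℕ∞)}
    rw [← h1, ← h2, ← h3]
    refine Eq.trans ?_ this
    congr 1
    ext ω
    simp [F, Fin.forall_fin_succ]
  have hcond : ∀ n, (1 - (K : ℝ≥0∞)⁻¹) ^ n * Pr (F n) ≤ Pr (isolated X Z D W V ∩ F n) := by
    intro n
    let E : Set ((ℕ → S) × (ℕ → Fin K)) :=
      {y | {i | y.1 i ∈ D}.encard = 1 ∧ {i | y.1 i ∈ W}.encard = 0 ∧
        {i | y.1 i ∈ V}.encard = n ∧ ∀ i j, y.1 i ∈ D → y.1 j ∈ V → y.2 i ≠ y.2 j}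
    have hE : MeasurableSet E := by
      refine ((measurable_encard_index hD).comp measurable_fst (measurableSet_singleton 1)).inter
        (((measurable_encard_index hW).comp measurable_fst (measurableSet_singleton 0)).inter
        (((measurable_encard_index hV).comp measurable_fst
          (measurableSet_singleton (n : ℕ∞))).inter ?_))
      have hf : ∀ i, Measurable fun y : (ℕ → S) × (ℕ → Fin K) => y.1 i := fun i =>
        (measurable_pi_apply i).comp measurable_fst
      have hs : ∀ i, Measurable fun y : (ℕ → S) × (ℕ → Fin K) => y.2 i := fun i =>
        (measurable_pi_apply i).comp measurable_snd
      exact measurableSet_forall_label_ne hf hs hD hV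
    have hEq : isolated X Z D W V ∩ F n =
        {ω | ((fun i => X i ω), fun i => Z i ω) ∈ E} := by
      ext ω
      simp only [isolated, F, E, pointCount, Set.mem_inter_iff, Set.mem_ofPred_eq]
      tauto
    rw [hEq, measure_eq_lintegral_of_indepFun hX.measurable_points hZ.measurable_labels
      hZ.indep_points hE, ← lintegral_indicator_const (hFm n)]
    -- The inner integrand fixes the points at `ω` and redraws only the labels `ω'`; on `F n` its
    -- value is at least the label probability.
    refine lintegral_mono fun ω => Set.indicator_apply_le' ?_ fun _ => zero_le
    rintro ⟨h1, h2, h3⟩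
    obtain ⟨i₀, hi₀⟩ := Set.encard_eq_one.1 h1
    have hfin : {i | X i ω ∈ V}.Finite := Set.finite_of_encard_eq_coe h3
    have hcard : hfin.toFinset.card = n := by
      have := hfin.encard_eq_coe_toFinset_card
      exact_mod_cast this.symm.trans h3
    have hi₀D : X i₀ ω ∈ D := (Set.ext_iff.1 hi₀ i₀).2 rfl
    have hmem : i₀ ∉ hfin.toFinset := by
      simpa using fun h => Set.disjoint_left.1 hDV hi₀D h
    rw [← hcard, ← hZ.measure_forall_ne_label hK hmem]
    refine measure_mono fun ω' h => ⟨h1, h2, hcard ▸ h3, fun i j hi hj => ?_⟩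
    obtain rfl : i = i₀ := (Set.ext_iff.1 hi₀ i).1 hi
    exact h j (by simpa using hj)
  have hdisj : Pairwise (Function.onFun Disjoint fun n => isolated X Z D W V ∩ F n) := by
    intro m n hmn
    refine Set.disjoint_left.2 fun ω hm hn => hmn ?_
    exact_mod_cast hm.2.2.2.symm.trans hn.2.2.2
  calc _ = ∑' n : ℕ, (1 - (K : ℝ≥0∞)⁻¹) ^ n * Pr (F n) := by
        have h1 := poissonLaw_singleton hνD 1
        have h0 := poissonLaw_singleton hνW 0
        simp only [pow_one, Nat.factorial_one, Nat.cast_one, div_one] at h1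
        simp only [pow_zero, mul_one, Nat.factorial_zero, Nat.cast_one, div_one,
          Nat.cast_zero] at h0
        have hterm : ∀ n : ℕ, (1 - (K : ℝ≥0∞)⁻¹) ^ n * Pr (F n) =
            poissonLaw (ν D) {1} * poissonLaw (ν W) {0} * (ENNReal.ofReal (1 - (K : ℝ)⁻¹) ^ n *
              ENNReal.ofReal (Real.exp (-(ν V).toReal) * (ν V).toReal ^ n / n.factorial)) := by
          intro n
          rw [hF, hq, poissonLaw_singleton hνV]; ring
        rw [tsum_congr hterm, ENNReal.tsum_mul_left, tsum_thinned_poisson ENNReal.toReal_nonneg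
          (inv_le_one_of_one_le₀ (by exact_mod_cast hK)), h1, h0,
          ← ENNReal.ofReal_mul (by positivity), ← ENNReal.ofReal_mul (by positivity)]
        congr 1
        rw [show -((ν D).toReal + (ν W).toReal + (ν V).toReal / K) =
          -(ν D).toReal + -(ν W).toReal + -((K : ℝ)⁻¹ * (ν V).toReal) by ring, Real.exp_add,
          Real.exp_add]
        ring
    _ ≤ ∑' n : ℕ, Pr (isolated X Z D W V ∩ F n) := ENNReal.tsum_le_tsum hcond
    _ = Pr (⋃ n, isolated X Z D W V ∩ F n) := (measure_iUnion hdisj fun n =>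
        (hX.measurableSet_isolated hZ.measurable_label hD hW hV).inter (hFm n)).symm
    _ ≤ Pr (isolated X Z D W V) := measure_mono (Set.iUnion_subset fun n => Set.inter_subset_left)

end Isolated

/-! ### Points that win both races. -/

section CommonMinimizer

variable {Ω S : Type*} {K : ℕ} {Z : ℕ → Ω → Fin K}
  {X : ℕ → Ω → S}

/-- The event that a point in `A` is the strict minimizer of `h₁` among all points, and of `h₂`
among the points with the same label. -/
def commonMinimizer (X : ℕ → Ω → S) (Z : ℕ → Ω → Fin K) (h₁ h₂ : S → ℝ≥0∞) (A : Set S) : Set Ω :=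
  {ω | ∃ i, X i ω ∈ A ∧ (∀ j, j ≠ i → h₁ (X i ω) < h₁ (X j ω)) ∧
    ∀ j, j ≠ i → Z j ω = Z i ω → h₂ (X i ω) < h₂ (X j ω)}

/-- The point in `D` is the only one with `h₁ < t`, and its `h₂` is below `c * t`. A competitor with
the same label and no larger `h₂` would have `h₂ < c * t` and `h₁ ≥ t`, hence lie in the third set,
where that label is excluded. -/
theorem isolated_subset_commonMinimizer {h₁ h₂ : S → ℝ≥0∞} {A : Set S} {c t : ℝ≥0} (hc : c ≠ 0)
    (hA : ∀ x ∈ A, h₂ x ≤ c * h₁ x) {D : Set S} (hD : D ⊆ A ∩ {x | h₁ x < t}) :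
    isolated X Z D ({x | h₁ x < t} \ D) ({x | h₂ x < (c * t : ℝ≥0)} \ {x | h₁ x < t}) ⊆
      commonMinimizer X Z h₁ h₂ A := by
  rintro ω ⟨hD1, hW0, hV⟩
  obtain ⟨i, hi⟩ := Set.encard_eq_one.1 hD1
  have hiD : X i ω ∈ D := (Set.ext_iff.1 hi i).2 rfl
  have hge : ∀ j, j ≠ i → ¬ h₁ (X j ω) < t := by
    intro j hj hlt
    have hjD : X j ω ∉ D := fun h => hj ((Set.ext_iff.1 hi j).1 h)
    exact (Set.ext_iff.1 (Set.encard_eq_zero.1 hW0) j).1 ⟨hlt, hjD⟩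
  obtain ⟨hiA, hit : h₁ (X i ω) < t⟩ := hD hiD
  have hi2 : h₂ (X i ω) < (c * t : ℝ≥0) := by
    refine (hA _ hiA).trans_lt ?_
    rw [ENNReal.coe_mul]
    exact ENNReal.mul_lt_mul_right (by exact_mod_cast hc) (by simp) hit
  refine ⟨i, hiA, fun j hj => hit.trans_le (not_lt.1 (hge j hj)), fun j hj hZj => ?_⟩
  by_contra hlt
  exact hV i j hiD ⟨(not_lt.1 hlt).trans_lt hi2, hge j hj⟩ hZj.symm

theorem ofReal_le_tsum_geometric {a b δ : ℝ} (ha : 0 ≤ a) (hb : 0 < b) (hδ : 0 < δ) :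
    ENNReal.ofReal (a / b * Real.exp (-(δ * b))) ≤
      ∑' j : ℕ, ENNReal.ofReal (δ * a * Real.exp (-((j + 1) * δ * b))) := by
  have hr1 : Real.exp (-(δ * b)) < 1 := Real.exp_lt_one_iff.2 (by nlinarith)
  have hs := (hasSum_geometric_of_lt_one (Real.exp_nonneg _) hr1).mul_left
    (δ * a * Real.exp (-(δ * b)))
  have hterm : ∀ j : ℕ, δ * a * Real.exp (-(δ * b)) * Real.exp (-(δ * b)) ^ j =
      δ * a * Real.exp (-((j + 1) * δ * b)) := by
    intro j
    rw [← Real.exp_nat_mul, mul_assoc (δ * a), ← Real.exp_add]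
    congr 2; ring
  simp only [hterm] at hs
  rw [← ENNReal.ofReal_tsum_of_nonneg (fun j => by positivity) hs.summable, hs.tsum_eq]
  -- The geometric sum is `δ * a * exp (-(δ * b)) / (1 - exp (-(δ * b)))`, and `1 - exp (-(δ * b)) ≤
  -- δ * b`.
  refine ENNReal.ofReal_le_ofReal ?_
  have h1 : 0 < 1 - Real.exp (-(δ * b)) := by linarith
  have h2 := Real.one_sub_le_exp_neg (δ * b)
  rw [← div_eq_mul_inv, div_mul_eq_mul_div, div_le_div_iff₀ hb h1]
  have h3 : 0 ≤ a * Real.exp (-(δ * b)) := by positivity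
  nlinarith

/-- A Riemann sum for `∫ a * exp (-t * (1 + w / K)) dt`: slice `j` stands for the minimal `h₁`-value
lying in `[j δ, (j + 1) δ)`, with all exponents taken at the right endpoint `t j`. The loss factor
`exp (-δ * (1 + w / K))` disappears as `δ` tends to `0`. -/
theorem le_measure_commonMinimizer [MeasurableSpace Ω] [MeasurableSpace S] {Pr : Measure Ω}
    [IsProbabilityMeasure Pr] {ν : Measure S}
    (hX : IsPoissonProcess X ν Pr) (hZ : IsUniformLabelling Z X Pr) (hK : 1 ≤ K)
    {h₁ h₂ : S → ℝ≥0∞} (hh₁ : Measurable h₁) (hh₂ : Measurable h₂) {A : Set S}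
    (hAm : MeasurableSet A) {a c w : ℝ≥0} (hc : c ≠ 0) (hA : ∀ x ∈ A, h₂ x ≤ c * h₁ x)
    (hνA : ∀ s d : ℝ≥0, ν (A ∩ {x | (s : ℝ≥0∞) ≤ h₁ x ∧ h₁ x < s + d}) = d * a)
    (hν₁ : ∀ t : ℝ≥0, ν {x | h₁ x < t} ≤ t)
    (hν₂ : ∀ t : ℝ≥0, ν ({x | h₂ x < (c * t : ℝ≥0)} \ {x | h₁ x < t}) ≤ w * t) :
    ENNReal.ofReal (a / (1 + w / K)) ≤ Pr (commonMinimizer X Z h₁ h₂ A) := by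
  have hKpos : (0 : ℝ) < K := by exact_mod_cast hK
  have hbpos : (0 : ℝ) < 1 + w / K := by positivity
  suffices h : ∀ n : ℕ, ENNReal.ofReal (a / (1 + w / K) *
      Real.exp (-(1 / ((n : ℝ) + 1) * (1 + w / K)))) ≤ Pr (commonMinimizer X Z h₁ h₂ A) by
    refine le_of_tendsto' (x := Filter.atTop) ?_ h
    have h0 := ((tendsto_one_div_add_atTop_nhds_zero_nat (𝕜 := ℝ)).mul_const
      (1 + (w : ℝ) / K)).neg.rexp.const_mul ((a : ℝ) / (1 + w / K))
    simp only [zero_mul, neg_zero, Real.exp_zero, mul_one] at h0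
    exact (ENNReal.continuous_ofReal.tendsto _).comp h0
  intro n
  obtain ⟨δ, hδ⟩ : ∃ δ : ℝ≥0, (δ : ℝ) = 1 / ((n : ℝ) + 1) := ⟨⟨_, by positivity⟩, rfl⟩
  have hδpos : 0 < (δ : ℝ) := by rw [hδ]; positivity
  let t (j : ℕ) : ℝ≥0 := j * δ + δ
  let D (j : ℕ) : Set S := A ∩ {x | ((j * δ : ℝ≥0) : ℝ≥0∞) ≤ h₁ x ∧ h₁ x < (j * δ : ℝ≥0) + δ}
  let W (j : ℕ) : Set S := {x | h₁ x < t j} \ D j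
  let V (j : ℕ) : Set S := {x | h₂ x < (c * t j : ℝ≥0)} \ {x | h₁ x < t j}
  have hDm : ∀ j, MeasurableSet (D j) := fun j =>
    hAm.inter ((measurableSet_le measurable_const hh₁).inter (measurableSet_lt hh₁ measurable_const))
  have hlt : ∀ j, MeasurableSet {x | h₁ x < t j} := fun j => measurableSet_lt hh₁ measurable_const
  have hVm : ∀ j, MeasurableSet (V j) := fun j =>
    (measurableSet_lt hh₂ measurable_const).diff (hlt j)
  have hDsub : ∀ j, D j ⊆ A ∩ {x | h₁ x < t j} := fun j x hx =>
    ⟨hx.1, by simpa [t] using hx.2.2⟩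
  have hmeas : ∀ j : ℕ, ENNReal.ofReal (δ * a * Real.exp (-((j + 1) * δ * (1 + w / K)))) ≤
      Pr (isolated X Z (D j) (W j) (V j)) := by
    intro j
    have hDν : ν (D j) = δ * a := hνA (j * δ) δ
    have hVν : ν (V j) ≤ w * t j := hν₂ (t j)
    have hWD : ν (D j) + ν (W j) ≤ t j := by
      rw [measure_add_sdiff (hDm j).nullMeasurableSet]
      refine (measure_mono ?_).trans (hν₁ (t j))
      exact Set.union_subset ((hDsub j).trans Set.inter_subset_right) subset_rfl
    have hDtop : ν (D j) ≠ ∞ := hDν ▸ ENNReal.mul_ne_top (by simp) (by simp)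
    have hWtop : ν (W j) ≠ ∞ := ne_top_of_le_ne_top (by simp) (le_add_self.trans hWD)
    have hVtop : ν (V j) ≠ ∞ := ne_top_of_le_ne_top (ENNReal.mul_ne_top (by simp) (by simp)) hVν
    refine le_trans (ENNReal.ofReal_le_ofReal ?_) (le_measure_isolated hX hZ hK (hDm j)
      ((hlt j).diff (hDm j)) (hVm j) Set.disjoint_sdiff_right ?_ ?_ hDtop hWtop hVtop)
    · have hD' : (ν (D j)).toReal = δ * a := by rw [hDν]; simp
      have hVr : (ν (V j)).toReal ≤ w * t j := by
        simpa using ENNReal.toReal_mono (ENNReal.mul_ne_top (by simp) (by simp)) hVν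
      have hWr : (ν (D j)).toReal + (ν (W j)).toReal ≤ t j := by
        rw [← ENNReal.toReal_add hDtop hWtop]
        simpa using ENNReal.toReal_mono (by simp) hWD
      have ht : (t j : ℝ) = (j + 1) * δ := by simp only [t]; push_cast; ring
      rw [hD'] at *
      gcongr
      have : (ν (V j)).toReal / K ≤ w * t j / K := by gcongr
      calc _ ≤ (t j : ℝ) + w * t j / K := add_le_add hWr this
        _ = _ := by rw [ht]; ring
    · exact Set.disjoint_left.2 fun x hx hxV => hxV.2 (hDsub j hx).2
    · exact Set.disjoint_left.2 fun x hx hxV => hxV.2 hx.1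
  have hdisj : Pairwise (Function.onFun Disjoint fun j => isolated X Z (D j) (W j) (V j)) := by
    refine (pairwise_disjoint_on _).2 fun j l hjl => Set.disjoint_left.2 fun ω hj hl => ?_
    obtain ⟨i, hi⟩ := Set.encard_eq_one.1 hj.1
    have hiD : X i ω ∈ D j := (Set.ext_iff.1 hi i).2 rfl
    have htl : ((t j : ℝ≥0) : ℝ≥0∞) ≤ (l * δ : ℝ≥0) := by
      have : ((j + 1 : ℕ) : ℝ≥0) * δ ≤ l * δ := by
        gcongr
        exact hjl
      push_cast at this
      rw [add_mul, one_mul] at this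
      exact_mod_cast this
    have h1 : h₁ (X i ω) < (l * δ : ℝ≥0) := lt_of_lt_of_le (hDsub j hiD).2 htl
    -- For `j < l`, the point in slice `j` has `h₁` below slice `l`, so it lies in `W l`, which
    -- should be empty.
    refine (Set.ext_iff.1 (Set.encard_eq_zero.1 hl.2.1) i).1 ⟨?_, fun h => ?_⟩
    · exact h1.trans_le (by simp only [t]; exact_mod_cast le_self_add)
    · exact absurd h.2.1 (not_le.2 h1)
  rw [← hδ]
  calc _ ≤ ∑' j : ℕ, ENNReal.ofReal (δ * a * Real.exp (-((j + 1) * δ * (1 + w / K)))) :=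
        ofReal_le_tsum_geometric a.2 hbpos hδpos
    _ ≤ ∑' j, Pr (isolated X Z (D j) (W j) (V j)) := ENNReal.tsum_le_tsum hmeas
    _ = Pr (⋃ j, isolated X Z (D j) (W j) (V j)) := (measure_iUnion hdisj fun j =>
        hX.measurableSet_isolated hZ.measurable_label (hDm j) ((hlt j).diff (hDm j))
          (hVm j)).symm
    _ ≤ _ := measure_mono (Set.iUnion_subset fun j =>
        isolated_subset_commonMinimizer hc hA (hDsub j))

end CommonMinimizer

/-! ### Intensity of the points in a range of scores. -/

theorem lebesgueNNReal_Ico (a b : ℝ≥0) : lebesgueNNReal (Set.Ico a b) = ((b - a : ℝ≥0) : ℝ≥0∞) := by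
  have h : (fun t : ℝ≥0 => (t : ℝ)) '' Set.Ico a b = Set.Ico (a : ℝ) b := by
    ext x
    simp only [Set.mem_image, Set.mem_Ico]
    constructor
    · rintro ⟨t, ht, rfl⟩
      exact_mod_cast ht
    · rintro ⟨h1, h2⟩
      exact ⟨⟨x, a.2.trans h1⟩, ⟨h1, h2⟩, rfl⟩
  have hemb : MeasurableEmbedding (fun t : ℝ≥0 => (t : ℝ)) :=
    MeasurableEmbedding.subtype_coe measurableSet_Ici
  rw [lebesgueNNReal, hemb.comap_apply, h, Real.volume_Ico, ENNReal.ofReal]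
  congr 1

theorem lebesgueNNReal_singleton (a : ℝ≥0) : lebesgueNNReal {a} = 0 := by
  have hemb : MeasurableEmbedding (fun t : ℝ≥0 => (t : ℝ)) :=
    MeasurableEmbedding.subtype_coe measurableSet_Ici
  rw [lebesgueNNReal, hemb.comap_apply, Set.image_singleton, Real.volume_singleton]

instance : SigmaFinite lebesgueNNReal :=
  ⟨⟨⟨fun n => Set.Ico 0 (n : ℝ≥0), fun _ => trivial, fun n => by simp [lebesgueNNReal_Ico],
    Set.eq_univ_of_forall fun t => Set.mem_iUnion.2 <|
      (exists_nat_gt t).imp fun _ h => ⟨zero_le, h⟩⟩⟩⟩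

theorem lebesgueNNReal_div (f s d : ℝ≥0) :
    lebesgueNNReal {t | (s : ℝ≥0∞) ≤ (t : ℝ≥0∞) / f ∧ (t : ℝ≥0∞) / f < s + d} = d * f := by
  rcases eq_or_ne f 0 with rfl | hf
  · simp only [ENNReal.coe_zero, mul_zero]
    -- With zero density every `t ≠ 0` has quotient `∞`; only `t = 0` survives, because `0 / 0 = 0`.
    refine measure_mono_null (fun t ht => ?_) (lebesgueNNReal_singleton 0)
    by_contra h0
    have : (t : ℝ≥0∞) / 0 = ∞ := ENNReal.div_zero (by exact_mod_cast h0)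
    have h2 := this ▸ ht.2
    exact absurd h2 (by simp)
  · have : {t : ℝ≥0 | (s : ℝ≥0∞) ≤ (t : ℝ≥0∞) / f ∧ (t : ℝ≥0∞) / f < s + d} =
        Set.Ico (s * f) ((s + d) * f) := by
      ext t
      rw [Set.mem_ofPred_eq, ← ENNReal.coe_div hf, Set.mem_Ico, ← le_div_iff₀ (by positivity),
        ← div_lt_iff₀ (by positivity)]
      norm_cast
    rw [this, lebesgueNNReal_Ico, add_mul, add_tsub_cancel_left, ENNReal.coe_mul]

section Score

variable {𝓤 : Type*} [MeasurableSpace 𝓤] {θ μ P : Measure 𝓤}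

theorem measurable_score (θ μ P : Measure 𝓤) :
    Measurable (fun x : 𝓤 × ℝ≥0 => score θ μ P x.1 x.2) := by
  unfold score
  have h1 := Measure.measurable_rnDeriv μ θ
  have h2 := Measure.measurable_rnDeriv P θ
  fun_prop

variable [SigmaFinite θ] [SigmaFinite μ] [IsProbabilityMeasure P]

/-- By the chain rule for densities, `μ(u)` cancels, being positive and finite `μ`-almost
everywhere; the reference measure `θ` drops out. -/
theorem ae_score_eq (hμ : μ ≪ θ) (hP : P ≪ μ) :
    ∀ᵐ u ∂μ, ∀ t : ℝ≥0, score θ μ P u t = t / P.rnDeriv μ u := by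
  filter_upwards [hμ.ae_le (Measure.rnDeriv_mul_rnDeriv (κ := θ) hP), Measure.rnDeriv_pos hμ,
    hμ.ae_le (Measure.rnDeriv_lt_top μ θ)] with u hu hpos htop t
  rw [score, ← hu, Pi.mul_apply, ENNReal.mul_div_mul_right _ _ hpos.ne' htop.ne]

/-- Over a location `u` the admissible times fill length `d * dP/dμ(u)`; integrating over `A`
against `μ` gives `d * P A`. -/
theorem measure_score_Ico (hμ : μ ≪ θ) (hP : P ≪ μ) {A : Set 𝓤} (hA : MeasurableSet A)
    (s d : ℝ≥0) :
    μ.prod lebesgueNNReal (Prod.fst ⁻¹' A ∩ {x | (s : ℝ≥0∞) ≤ score θ μ P x.1 x.2 ∧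
      score θ μ P x.1 x.2 < s + d}) = d * P A := by
  have hm := measurable_score θ μ P
  have hset : MeasurableSet {x : 𝓤 × ℝ≥0 | (s : ℝ≥0∞) ≤ score θ μ P x.1 x.2 ∧
      score θ μ P x.1 x.2 < s + d} :=
    (measurableSet_le measurable_const hm).inter (measurableSet_lt hm measurable_const)
  rw [Measure.prod_apply ((measurable_fst hA).inter hset)]
  have : ∀ᵐ u ∂μ, lebesgueNNReal (Prod.mk u ⁻¹' (Prod.fst ⁻¹' A ∩
      {x | (s : ℝ≥0∞) ≤ score θ μ P x.1 x.2 ∧ score θ μ P x.1 x.2 < s + d})) =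
      A.indicator (fun u => d * P.rnDeriv μ u) u := by
    filter_upwards [ae_score_eq hμ hP, Measure.rnDeriv_lt_top P μ] with u hu htop
    by_cases huA : u ∈ A
    · lift P.rnDeriv μ u to ℝ≥0 using htop.ne with f hf
      rw [Set.indicator_of_mem huA, ← hf, ← lebesgueNNReal_div f s d]
      congr 1
      ext t
      simp [huA, hu]
    · rw [Set.indicator_of_notMem huA]
      convert measure_empty (μ := lebesgueNNReal)
      ext t
      simp [huA]
  rw [lintegral_congr_ae this, lintegral_indicator hA,
    lintegral_const_mul _ (Measure.measurable_rnDeriv P μ), Measure.setLIntegral_rnDeriv hP]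

theorem measure_score_lt (hμ : μ ≪ θ) (hP : P ≪ μ) (t : ℝ≥0) :
    μ.prod lebesgueNNReal {x | score θ μ P x.1 x.2 < t} = t := by
  simpa using measure_score_Ico hμ hP MeasurableSet.univ 0 t

theorem measure_score_lt_top (hμ : μ ≪ θ) (hP : P ≪ μ) :
    μ.prod lebesgueNNReal {x | score θ μ P x.1 x.2 < ∞} = ∞ := by
  refine ENNReal.eq_top_of_forall_nnreal_le fun t => ?_
  rw [← measure_score_lt hμ hP t]
  refine measure_mono fun x hx => ?_
  rw [Set.mem_ofPred_eq] at hx ⊢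
  exact lt_top_of_lt hx

end Score

/-! ### Existence, uniqueness and measurability of minimizers. -/

section Argmin

theorem argmin_eq_of_isArgmin {I : Set ℕ} {s : ℕ → ℝ≥0∞} {i : ℕ} (hi : i ∈ I)
    (h : ∀ j ∈ I, j ≠ i → s i < s j) : argmin I s = i := by
  have : {j | IsArgmin I s j} = {i} := by
    ext j
    refine ⟨fun hj => ?_, ?_⟩
    · by_contra hne
      exact absurd (hj.2 i hi) (not_le.2 (h j hj.1 hne))
    · rintro rfl
      refine ⟨hi, fun l hl => ?_⟩
      rcases eq_or_ne l j with rfl | hne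
      · exact le_rfl
      · exact (h l hl hne).le
  rw [argmin, this, csInf_singleton]

theorem existsUnique_isArgmin {I : Set ℕ} {s : ℕ → ℝ≥0∞}
    (hfin : ∀ n : ℕ, {i | s i < n}.Finite) (hI : ∃ i ∈ I, s i < ∞)
    (hne : ∀ i j, i ≠ j → s i < ∞ → s i ≠ s j) : ∃! i, IsArgmin I s i := by
  obtain ⟨i₀, hi₀, hlt⟩ := hI
  obtain ⟨n, hn⟩ := ENNReal.exists_nat_gt hlt.ne
  obtain ⟨i, ⟨hiI, hin⟩, hmin⟩ := Set.exists_min_image (I ∩ {i | s i < n}) s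
    ((hfin n).subset Set.inter_subset_right) ⟨i₀, hi₀, hn⟩
  have hi : IsArgmin I s i := by
    refine ⟨hiI, fun j hj => ?_⟩
    by_cases hjn : s j < n
    · exact hmin j ⟨hj, hjn⟩
    · exact hin.le.trans (not_lt.1 hjn)
  refine ⟨i, hi, fun j hj => ?_⟩
  by_contra hji
  exact hne i j (Ne.symm hji) (hin.trans (by simp)) (le_antisymm (hi.2 j hj.1) (hj.2 i hiI))

theorem measurable_argmin {Ω : Type*} [MeasurableSpace Ω] {I : Ω → Set ℕ} {s : ℕ → Ω → ℝ≥0∞}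
    (hI : ∀ i, MeasurableSet {ω | i ∈ I ω}) (hs : ∀ i, Measurable (s i)) :
    Measurable (fun ω => argmin (I ω) (fun i => s i ω)) := by
  have harg : ∀ i, MeasurableSet {ω | IsArgmin (I ω) (fun i => s i ω) i} := by
    intro i
    have : {ω | IsArgmin (I ω) (fun i => s i ω) i} =
        {ω | i ∈ I ω} ∩ ⋂ j, ({ω | j ∈ I ω}ᶜ ∪ {ω | s i ω ≤ s j ω}) := by
      ext ω; simp [IsArgmin, imp_iff_not_or]
    rw [this]
    exact (hI i).inter (.iInter fun j => (hI j).compl.union (measurableSet_le (hs i) (hs j)))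
  refine measurable_to_countable' fun n => ?_
  -- The second piece accounts for `sInf ∅ = 0`: without a minimizer the index is `0`.
  have : (fun ω => argmin (I ω) (fun i => s i ω)) ⁻¹' {n} =
      ({ω | IsArgmin (I ω) (fun i => s i ω) n} ∩
        ⋂ j, ⋂ _ : j < n, {ω | IsArgmin (I ω) (fun i => s i ω) j}ᶜ) ∪
      ({ω | n = 0} ∩ ⋂ j, {ω | IsArgmin (I ω) (fun i => s i ω) j}ᶜ) := by
    ext ω
    simp only [Set.mem_preimage, Set.mem_singleton_iff, Set.mem_union, Set.mem_inter_iff,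
      Set.mem_iInter, Set.mem_compl_iff, Set.mem_ofPred_eq, argmin]
    constructor
    · rintro rfl
      rcases Set.eq_empty_or_nonempty {i | IsArgmin (I ω) (fun i => s i ω) i} with h | h
      · right
        exact ⟨by rw [h, Nat.sInf_empty], fun j hj => (Set.ext_iff.1 h j).1 hj⟩
      · exact Or.inl ⟨Nat.sInf_mem h, fun j hj => Nat.notMem_of_lt_sInf hj⟩
    · rintro (⟨hn, hlt⟩ | ⟨rfl, h⟩)
      · refine le_antisymm (Nat.sInf_le hn) (not_lt.1 fun hl => ?_)
        exact hlt _ hl (Nat.sInf_mem (s := {i | IsArgmin (I ω) (fun i => s i ω) i}) ⟨n, hn⟩)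
      · rw [show {i | IsArgmin (I ω) (fun i => s i ω) i} = ∅ from
          Set.eq_empty_of_forall_notMem h, Nat.sInf_empty]
  rw [this]
  exact ((harg n).inter (.iInter fun j => .iInter fun _ => (harg j).compl)).union
    ((MeasurableSet.const _).inter (.iInter fun j => (harg j).compl))

end Argmin

theorem measurable_apply_index {Ω α : Type*} [MeasurableSpace Ω] [MeasurableSpace α]
    {U : ℕ → Ω → α} {N : Ω → ℕ} (hU : ∀ i, Measurable (U i)) (hN : Measurable N) :
    Measurable (fun ω => U (N ω) ω) := by
  intro s hs
  have : (fun ω => U (N ω) ω) ⁻¹' s = ⋃ n, N ⁻¹' {n} ∩ U n ⁻¹' s := by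
    ext ω; simp
  rw [this]
  exact .iUnion fun n => (hN (measurableSet_singleton n)).inter (hU n hs)

section Measurability

variable {Ω 𝓤 : Type*} [MeasurableSpace Ω] [MeasurableSpace 𝓤] {K : ℕ}
  {U : ℕ → Ω → 𝓤} {T : ℕ → Ω → ℝ≥0} {Z : ℕ → Ω → Fin K}

theorem measurable_selected (θ μ P : Measure 𝓤) (hU : ∀ i, Measurable (U i))
    (hT : ∀ i, Measurable (T i)) : Measurable (selected θ μ P U T) :=
  measurable_apply_index hU <| measurable_argmin (I := fun _ => Set.univ)
    (fun _ => MeasurableSet.const _)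
    fun i => (measurable_score θ μ P).comp ((hU i).prodMk (hT i))

theorem measurable_selectedLabel (θ μ Q : Measure 𝓤) (hU : ∀ i, Measurable (U i))
    (hT : ∀ i, Measurable (T i)) (hZ : ∀ i, Measurable (Z i)) (k : Fin K) :
    Measurable (selectedLabel θ μ Q U T Z k) :=
  measurable_apply_index hU <| measurable_argmin (I := fun ω => {i | Z i ω = k})
    (fun i => hZ i (measurableSet_singleton k))
    fun i => (measurable_score θ μ Q).comp ((hU i).prodMk (hT i))

theorem measurableSet_mismatch [StandardBorelSpace 𝓤] (θ μ P Q : Measure 𝓤)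
    (hU : ∀ i, Measurable (U i)) (hT : ∀ i, Measurable (T i)) (hZ : ∀ i, Measurable (Z i)) :
    MeasurableSet (mismatch θ μ P Q U T Z) := by
  have : mismatch θ μ P Q U T Z =
      ⋂ k, {ω | selectedLabel θ μ Q U T Z k ω = selected θ μ P U T ω}ᶜ := by
    ext ω; simp [mismatch]
  rw [this]
  exact .iInter fun k => (measurableSet_eq_fun (measurable_selectedLabel θ μ Q hU hT hZ k)
    (measurable_selected θ μ P hU hT)).compl

end Measurability

theorem score_le_mul_score {𝓤 : Type*} [MeasurableSpace 𝓤] {θ μ P Q : Measure 𝓤} {u : 𝓤}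
    {c : ℝ≥0} (hc : c ≠ 0) (h : P.rnDeriv θ u ≤ c * Q.rnDeriv θ u) (t : ℝ≥0) :
    score θ μ Q u t ≤ c * score θ μ P u t := by
  have hc0 : (c : ℝ≥0∞) ≠ 0 := by exact_mod_cast hc
  have hinv : (Q.rnDeriv θ u)⁻¹ ≤ c * (P.rnDeriv θ u)⁻¹ := by
    have := ENNReal.inv_le_inv.2 h
    rw [ENNReal.mul_inv (Or.inl hc0) (Or.inl ENNReal.coe_ne_top)] at this
    calc (Q.rnDeriv θ u)⁻¹ = c * ((c : ℝ≥0∞)⁻¹ * (Q.rnDeriv θ u)⁻¹) := by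
          rw [← mul_assoc, ENNReal.mul_inv_cancel hc0 ENNReal.coe_ne_top, one_mul]
      _ ≤ _ := by gcongr
  simp only [score, div_eq_mul_inv]
  calc _ ≤ (t : ℝ≥0∞) * μ.rnDeriv θ u * (c * (P.rnDeriv θ u)⁻¹) := by gcongr
    _ = _ := by ring

/-! ### Law of the selected point and the conditional bound. -/

section Selection

variable {Ω 𝓤 : Type*} [MeasurableSpace Ω] {Pr : Measure Ω}
  [MeasurableSpace 𝓤] {θ μ P Q : Measure 𝓤} [SigmaFinite θ] [SigmaFinite μ]
  [IsProbabilityMeasure P] [IsProbabilityMeasure Q] {K : ℕ}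
  {U : ℕ → Ω → 𝓤} {T : ℕ → Ω → ℝ≥0} {Z : ℕ → Ω → Fin K}

section Existence

variable {X : ℕ → Ω → 𝓤 × ℝ≥0} (hX : IsPoissonProcess X (μ.prod lebesgueNNReal) Pr)
include hX

theorem ae_finite_score_lt (hμ : μ ≪ θ) (hP : P ≪ μ) :
    ∀ᵐ ω ∂Pr, ∀ n : ℕ, {i | score θ μ P (X i ω).1 (X i ω).2 < n}.Finite := by
  refine ae_all_iff.2 fun n => hX.ae_finite
    (B := {x | score θ μ P x.1 x.2 < ((n : ℝ≥0) : ℝ≥0∞)})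
    (measurableSet_lt (measurable_score θ μ P) measurable_const) ?_
  rw [measure_score_lt hμ hP]
  exact ENNReal.coe_ne_top

theorem ae_infinite_score_lt_top (hμ : μ ≪ θ) (hP : P ≪ μ) :
    ∀ᵐ ω ∂Pr, {i | X i ω ∈ {x | score θ μ P x.1 x.2 < ∞}}.Infinite :=
  hX.ae_infinite (measurableSet_lt (measurable_score θ μ P) measurable_const)
    (measure_score_lt_top hμ hP)

theorem ae_score_ne (hμ : μ ≪ θ) (hP : P ≪ μ) :
    ∀ᵐ ω ∂Pr, ∀ i j, i ≠ j → score θ μ P (X i ω).1 (X i ω).2 < ∞ →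
      score θ μ P (X i ω).1 (X i ω).2 ≠ score θ μ P (X j ω).1 (X j ω).2 :=
  hX.ae_ne_of_lt_top (measurable_score θ μ P) fun s d => by
    simpa using (measure_score_Ico hμ hP MeasurableSet.univ s d).le

theorem ae_existsUnique_argmin (hμ : μ ≪ θ) (hP : P ≪ μ) :
    ∀ᵐ ω ∂Pr, ∃! i, IsArgmin Set.univ (fun i => score θ μ P (X i ω).1 (X i ω).2) i := by
  filter_upwards [ae_finite_score_lt hX hμ hP, ae_infinite_score_lt_top hX hμ hP,
    ae_score_ne hX hμ hP] with ω hfin hinf hne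
  obtain ⟨i, hi⟩ := hinf.nonempty
  exact existsUnique_isArgmin hfin ⟨i, trivial, hi⟩ hne

theorem ae_existsUnique_argmin_label [IsProbabilityMeasure Pr] (hμ : μ ≪ θ) (hQ : Q ≪ μ) (hZ : IsUniformLabelling Z X Pr) :
    ∀ᵐ ω ∂Pr, ∀ k, ∃! i, IsArgmin {i | Z i ω = k}
      (fun i => score θ μ Q (X i ω).1 (X i ω).2) i := by
  filter_upwards [ae_finite_score_lt hX hμ hQ, ae_score_ne hX hμ hQ,
    hZ.ae_exists_label hX.measurable_point
      (measurableSet_lt (measurable_score θ μ Q) measurable_const)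
      (ae_infinite_score_lt_top hX hμ hQ)] with ω hfin hne hlab k
  obtain ⟨i, hi, hk⟩ := hlab k
  exact existsUnique_isArgmin hfin ⟨i, hk, hi⟩ hne

end Existence

variable [IsProbabilityMeasure Pr]
  (hUT : IsPoissonProcess (fun i ω => (U i ω, T i ω)) (μ.prod lebesgueNNReal) Pr)
  (hZ : IsUniformLabelling Z (fun i ω => (U i ω, T i ω)) Pr)
include hUT hZ

theorem le_measure_selected (hμ : μ ≪ θ) (hP : P ≪ μ) (hK : 1 ≤ K) {A : Set 𝓤}
    (hA : MeasurableSet A) : P A ≤ Pr (selected θ μ P U T ⁻¹' A) := by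
  -- With both scores equal and `c = 1` there are no extra competitors, so `w = 0` and the bound is
  -- `P A` itself.
  have h := le_measure_commonMinimizer hUT hZ hK (measurable_score θ μ P) (measurable_score θ μ P)
    (measurable_fst hA) (a := (P A).toNNReal) (c := 1) (w := 0) one_ne_zero
    (fun x _ => by simp) (fun s d => by
      rw [measure_score_Ico hμ hP hA, ENNReal.coe_toNNReal (measure_ne_top P A)])
    (fun t => (measure_score_lt hμ hP t).le) (fun t => by simp)
  simp only [NNReal.coe_zero, zero_div, add_zero, div_one, ENNReal.ofReal_coe_nnreal,
    ENNReal.coe_toNNReal (measure_ne_top P A)] at h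
  refine h.trans (measure_mono ?_)
  rintro ω ⟨i, hiA, hi, -⟩
  rw [Set.mem_preimage, selected, argmin_eq_of_isArgmin (Set.mem_univ i) fun j _ => hi j]
  exact hiA

/-- A lower bound valid for both `A` and its complement is an equality, as both measures have total
mass `1`. -/
theorem measure_selected (hμ : μ ≪ θ) (hP : P ≪ μ) (hK : 1 ≤ K) {A : Set 𝓤}
    (hA : MeasurableSet A) : Pr (selected θ μ P U T ⁻¹' A) = P A := by
  have hm : Measurable (selected θ μ P U T) := measurable_selected θ μ P
    (fun i => (hUT.measurable_point i).fst) (fun i => (hUT.measurable_point i).snd)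
  refine le_antisymm ?_ (le_measure_selected hUT hZ hμ hP hK hA)
  have h := le_measure_selected hUT hZ hμ hP hK hA.compl
  rw [Set.preimage_compl, prob_compl_eq_one_sub hA, prob_compl_eq_one_sub (hm hA)] at h
  exact (ENNReal.sub_le_sub_iff_left prob_le_one ENNReal.one_ne_top).1 h

theorem le_measure_match (hμ : μ ≪ θ) (hP : P ≪ μ) (hQ : Q ≪ μ) (hK : 1 ≤ K) {c : ℝ≥0}
    (hc : c ≠ 0) {A : Set 𝓤} (hA : MeasurableSet A)
    (hAc : ∀ u ∈ A, P.rnDeriv θ u ≤ c * Q.rnDeriv θ u) :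
    ENNReal.ofReal (P.real A / (1 + c / K)) ≤
      Pr (selected θ μ P U T ⁻¹' A ∩ (mismatch θ μ P Q U T Z)ᶜ) := by
  -- Here `w = c`: the competitors are bounded by all points of `Q`-score below `c * t`, of mass `c
  -- * t`.
  have h := le_measure_commonMinimizer hUT hZ hK (measurable_score θ μ P) (measurable_score θ μ Q)
    (measurable_fst hA) (a := (P A).toNNReal) (c := c) (w := c) hc
    (fun x hx => score_le_mul_score hc (hAc _ hx) _) (fun s d => by
      rw [measure_score_Ico hμ hP hA, ENNReal.coe_toNNReal (measure_ne_top P A)])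
    (fun t => (measure_score_lt hμ hP t).le) (fun t => by
      refine (measure_mono Set.sdiff_subset).trans ?_
      rw [measure_score_lt hμ hQ, ENNReal.coe_mul])
  refine h.trans (measure_mono ?_)
  rintro ω ⟨i, hiA, hi, hi'⟩
  have hsel : selected θ μ P U T ω = U i ω := by
    rw [selected, argmin_eq_of_isArgmin (Set.mem_univ i) fun j _ => hi j]
  refine ⟨?_, fun hmis => hmis ⟨Z i ω, ?_⟩⟩
  · rw [Set.mem_preimage, hsel]
    exact hiA
  · rw [hsel]
    simp only [selectedLabel]
    rw [argmin_eq_of_isArgmin (I := {j | Z j ω = Z i ω}) (i := i) rfl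
      fun j hj hne => hi' j hne hj]

theorem measureReal_mismatch_le [StandardBorelSpace 𝓤] (hμ : μ ≪ θ) (hP : P ≪ μ) (hQ : Q ≪ μ)
    (hK : 1 ≤ K) {c : ℝ≥0} (hc : c ≠ 0) {A : Set 𝓤} (hA : MeasurableSet A)
    (hAc : ∀ u ∈ A, P.rnDeriv θ u ≤ c * Q.rnDeriv θ u) :
    Pr.real (selected θ μ P U T ⁻¹' A ∩ mismatch θ μ P Q U T Z) ≤
      Pr.real (selected θ μ P U T ⁻¹' A) * (1 - (1 + (c : ℝ) / K)⁻¹) := by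
  have hM : MeasurableSet (mismatch θ μ P Q U T Z) := measurableSet_mismatch θ μ P Q
    (fun i => (hUT.measurable_point i).fst) (fun i => (hUT.measurable_point i).snd)
    hZ.measurable_label
  have h1 : P.real A / (1 + (c : ℝ) / K) ≤
      Pr.real (selected θ μ P U T ⁻¹' A \ mismatch θ μ P Q U T Z) :=
    (ENNReal.ofReal_le_iff_le_toReal (measure_ne_top _ _)).1
      (le_measure_match hUT hZ hμ hP hQ hK hc hA hAc)
  have h2 : Pr.real (selected θ μ P U T ⁻¹' A) = P.real A :=
    congrArg ENNReal.toReal (measure_selected hUT hZ hμ hP hK hA)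
  have h3 := measureReal_inter_add_sdiff (μ := Pr) (s := selected θ μ P U T ⁻¹' A) hM
  rw [h2] at h3 ⊢
  rw [div_eq_mul_inv] at h1
  linarith

theorem ae_condProb_mismatch_le [StandardBorelSpace 𝓤] (hμ : μ ≪ θ) (hP : P ≪ μ) (hQ : Q ≪ μ)
    (hK : 1 ≤ K) {c : ℝ≥0} (hc : c ≠ 0) :
    ∀ᵐ ω ∂Pr, P.rnDeriv θ (selected θ μ P U T ω) ≤ c * Q.rnDeriv θ (selected θ μ P U T ω) →
      (Pr⟦mismatch θ μ P Q U T Z |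
        MeasurableSpace.comap (selected θ μ P U T) inferInstance⟧) ω ≤ 1 - (1 + (c : ℝ) / K)⁻¹ := by
  have hU : ∀ i, Measurable (U i) := fun i => (hUT.measurable_point i).fst
  have hT : ∀ i, Measurable (T i) := fun i => (hUT.measurable_point i).snd
  have hM : MeasurableSet (mismatch θ μ P Q U T Z) :=
    measurableSet_mismatch θ μ P Q hU hT hZ.measurable_label
  set V := selected θ μ P U T with hV
  have hm : MeasurableSpace.comap V inferInstance ≤ (inferInstance : MeasurableSpace Ω) :=
    (measurable_selected θ μ P hU hT).comap_le
  set f := Pr⟦mismatch θ μ P Q U T Z | MeasurableSpace.comap V inferInstance⟧ with hf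
  set κ : ℝ := 1 - (1 + (c : ℝ) / K)⁻¹ with hκ
  have hκ0 : 0 ≤ κ := by
    have : (1 + (c : ℝ) / K)⁻¹ ≤ 1 := inv_le_one_of_one_le₀ (by
      have : 0 ≤ (c : ℝ) / K := by positivity
      linarith)
    linarith
  let B : Set 𝓤 := {u | P.rnDeriv θ u ≤ c * Q.rnDeriv θ u}
  have hB : MeasurableSet B := measurableSet_le (Measure.measurable_rnDeriv P θ)
    ((Measure.measurable_rnDeriv Q θ).const_mul _)
  have hfm : Measurable[MeasurableSpace.comap V inferInstance] f :=
    stronglyMeasurable_condExp.measurable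
  have hκm : MeasurableSet {ω | κ < f ω} := hm _ (hfm measurableSet_Ioi)
  -- The set where the bound fails inside `V ⁻¹' B` has the form `V ⁻¹' (C ∩ B)`. If it had positive
  -- measure, integrating `f` over it would give more than `κ` times its measure, against
  -- `measureReal_mismatch_le`.
  have hbad : Pr.restrict (V ⁻¹' B) {ω | κ < f ω} = 0 := by
    by_contra hne
    have hfi : Integrable f Pr := integrable_condExp
    have hlt := setIntegral_gt_gt hκ0 hfi.restrict.integrableOn hne
    obtain ⟨C, hC, hCf⟩ := hfm (measurableSet_Ioi (a := κ))
    have hset : {ω | κ < f ω} ∩ V ⁻¹' B = V ⁻¹' (C ∩ B) := by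
      rw [Set.preimage_inter, hCf]; rfl
    rw [Measure.restrict_restrict hκm, measureReal_restrict_apply hκm, hset,
      setIntegral_condExp hm ((integrable_const (1 : ℝ)).indicator hM) ⟨C ∩ B, hC.inter hB, rfl⟩,
      setIntegral_indicator hM, setIntegral_const, smul_eq_mul, mul_one] at hlt
    exact absurd hlt (not_lt.2 (measureReal_mismatch_le hUT hZ hμ hP hQ hK hc (hC.inter hB)
      fun u hu => hu.2))
  rw [Measure.restrict_apply hκm] at hbad
  filter_upwards [measure_eq_zero_iff_ae_notMem.1 hbad] with ω hω hle
  by_contra hlt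
  exact hω ⟨not_le.1 hlt, hle⟩

end Selection

/-! ### From fixed ratios `c` to the ratio at the selected point. -/

theorem mismatchBound_eq {𝓤 : Type*} [MeasurableSpace 𝓤] {K : ℕ} (hK : 1 ≤ K) {θ P Q : Measure 𝓤}
    {u : 𝓤} (hp : P.rnDeriv θ u ≠ ∞) (hq : Q.rnDeriv θ u ≠ 0) :
    mismatchBound K θ P Q u =
      1 - (1 + (P.rnDeriv θ u).toReal / (Q.rnDeriv θ u).toReal / K)⁻¹ := by
  have hK0 : (K : ℝ≥0∞) ≠ 0 := by simp; omega
  have hden : (K : ℝ≥0∞) * Q.rnDeriv θ u ≠ 0 := mul_ne_zero hK0 hq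
  rw [mismatchBound, ENNReal.toReal_sub_of_le (ENNReal.inv_le_one.2 le_self_add) (by simp),
    ENNReal.toReal_inv, ENNReal.toReal_add (by simp) (ENNReal.div_ne_top hp hden),
    ENNReal.toReal_div, ENNReal.toReal_mul, div_div, mul_comm]
  simp

theorem mismatchBound_eq_one {𝓤 : Type*} [MeasurableSpace 𝓤] {K : ℕ} {θ P Q : Measure 𝓤}
    {u : 𝓤} (hp : P.rnDeriv θ u ≠ 0) (hq : Q.rnDeriv θ u = 0) :
    mismatchBound K θ P Q u = 1 := by
  rw [mismatchBound, hq, mul_zero, ENNReal.div_zero hp]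
  simp

/-- Clearing denominators makes the inequality linear in `c`, namely `x * κ ≤ c * (1 - x)`. A single
`c` already forces `x < 1`, so dividing by `1 - x` leaves a lower bound on `c`, which passes to the
infimum `r`. -/
theorem le_one_sub_inv_of_forall_rat {x r κ : ℝ} (hr : 0 ≤ r) (hκ : 0 < κ)
    (h : ∀ c : ℚ, r < c → x ≤ 1 - (1 + (c : ℝ) / κ)⁻¹) : x ≤ 1 - (1 + r / κ)⁻¹ := by
  have key : ∀ c : ℝ, 0 ≤ c → (x ≤ 1 - (1 + c / κ)⁻¹ ↔ x * κ ≤ c * (1 - x)) := by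
    intro c hc
    have : 1 - (1 + c / κ)⁻¹ = c / (κ + c) := by
      field_simp
      ring
    rw [this, le_div_iff₀ (by positivity)]
    constructor <;> intro h <;> linarith
  obtain ⟨c₀, hc₀⟩ := exists_rat_gt r
  have h₀ := (key c₀ (hr.trans hc₀.le)).1 (h c₀ hc₀)
  have hx : 0 < 1 - x := by
    by_contra hx
    nlinarith [hr.trans hc₀.le]
  rw [key r hr, ← div_le_iff₀ hx]
  refine le_of_forall_lt_rat_imp_le fun c hc => ?_
  rw [div_le_iff₀ hx]
  exact (key c (hr.trans hc.le)).1 (h c hc)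

end ListPML

theorem lemma1 {Ω 𝓤 : Type*} [MeasurableSpace Ω] (Pr : Measure Ω) [IsProbabilityMeasure Pr]
    [MeasurableSpace 𝓤] [StandardBorelSpace 𝓤]
    (θ μ : Measure 𝓤) [SigmaFinite θ] [SigmaFinite μ] (hμ : μ ≪ θ)
    (P Q : Measure 𝓤) [IsProbabilityMeasure P] [IsProbabilityMeasure Q] (hP : P ≪ μ) (hQ : Q ≪ μ)
    (K : ℕ) (hK : 1 ≤ K)
    (U : ℕ → Ω → 𝓤) (T : ℕ → Ω → ℝ≥0) (Z : ℕ → Ω → Fin K)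
    (hUT : ListPML.IsPoissonProcess (fun i ω => (U i ω, T i ω))
      (μ.prod ListPML.lebesgueNNReal) Pr)
    (hZ : ListPML.IsUniformLabelling Z (fun i ω => (U i ω, T i ω)) Pr) :
    -- almost surely, all the minimizing indices exist and are unique
    (∀ᵐ ω ∂Pr,
      (∃! i, ListPML.IsArgmin Set.univ
        (fun i => ListPML.score θ μ P (U i ω) (T i ω)) i) ∧
      ∀ k, ∃! i, ListPML.IsArgmin {i | Z i ω = k}
        (fun i => ListPML.score θ μ Q (U i ω) (T i ω)) i) ∧
    -- the conditional probability below is one of an event given a random variable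
    Measurable (ListPML.selected θ μ P U T) ∧
    MeasurableSet (ListPML.mismatch θ μ P Q U T Z) ∧
    -- the bound on the conditional probability of a mismatch given `U_p`
    Pr⟦ListPML.mismatch θ μ P Q U T Z |
        MeasurableSpace.comap (ListPML.selected θ μ P U T) inferInstance⟧
      ≤ᵐ[Pr] fun ω => ListPML.mismatchBound K θ P Q (ListPML.selected θ μ P U T ω) := by
  have hU : ∀ i, Measurable (U i) := fun i => (hUT.measurable_point i).fst
  have hT : ∀ i, Measurable (T i) := fun i => (hUT.measurable_point i).snd
  have hsel := ListPML.measurable_selected θ μ P hU hT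
  refine ⟨(ListPML.ae_existsUnique_argmin hUT hμ hP).and (ListPML.ae_existsUnique_argmin_label hUT hμ hQ hZ),
    hsel, ListPML.measurableSet_mismatch θ μ P Q hU hT hZ.measurable_label, ?_⟩
  have hM := ListPML.measurableSet_mismatch θ μ P Q hU hT hZ.measurable_label
  have hlaw : Pr.map (ListPML.selected θ μ P U T) = P := Measure.ext fun A hA => by
    rw [Measure.map_apply hsel hA, ListPML.measure_selected hUT hZ hμ hP hK hA]
  have hdens : ∀ᵐ u ∂P, P.rnDeriv θ u ≠ 0 ∧ P.rnDeriv θ u ≠ ∞ ∧ Q.rnDeriv θ u ≠ ∞ := by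
    have hPθ := hP.trans hμ
    filter_upwards [Measure.rnDeriv_pos hPθ, hPθ.ae_le (Measure.rnDeriv_lt_top P θ),
      hPθ.ae_le (Measure.rnDeriv_lt_top Q θ)] with u h0 hp hq
    exact ⟨h0.ne', hp.ne, hq.ne⟩
  have hle_one : Pr⟦ListPML.mismatch θ μ P Q U T Z |
      MeasurableSpace.comap (ListPML.selected θ μ P U T) inferInstance⟧ ≤ᵐ[Pr] fun _ => (1 : ℝ) := by
    have h := condExp_mono (m := MeasurableSpace.comap (ListPML.selected θ μ P U T) inferInstance)
      ((integrable_const (μ := Pr) (1 : ℝ)).indicator hM) (integrable_const (1 : ℝ))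
      (.of_forall fun ω => Set.indicator_le_self' (fun _ _ => zero_le_one) ω)
    rwa [condExp_const hsel.comap_le] at h
  -- Rational `c` keep the exceptional null sets countable in number, so `c` may then depend on `ω`.
  have hbound : ∀ᵐ ω ∂Pr, ∀ c : ℚ, 0 < (c : ℝ) →
      P.rnDeriv θ (ListPML.selected θ μ P U T ω) ≤
        (c : ℝ).toNNReal * Q.rnDeriv θ (ListPML.selected θ μ P U T ω) →
      (Pr⟦ListPML.mismatch θ μ P Q U T Z |
        MeasurableSpace.comap (ListPML.selected θ μ P U T) inferInstance⟧) ω ≤ 1 - (1 + (c : ℝ) / K)⁻¹ := by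
    refine ae_all_iff.2 fun c => ?_
    by_cases hc : 0 < (c : ℝ)
    · filter_upwards [ListPML.ae_condProb_mismatch_le hUT hZ hμ hP hQ hK
        (Real.toNNReal_pos.2 hc).ne'] with ω hω _ h
      simpa [Real.coe_toNNReal _ hc.le] using hω h
    · exact .of_forall fun ω h => absurd h hc
  filter_upwards [ae_of_ae_map hsel.aemeasurable
    (hlaw.le.absolutelyContinuous.ae_le hdens), hle_one, hbound] with ω hω h1 hc
  obtain ⟨hp0, hp, hq⟩ := hω
  -- If `q` vanishes there while `p` does not, no finite `c` is available, but the bound is `1` and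
  -- holds trivially.
  by_cases hq0 : Q.rnDeriv θ (ListPML.selected θ μ P U T ω) = 0
  · rwa [ListPML.mismatchBound_eq_one hp0 hq0]
  · rw [ListPML.mismatchBound_eq hK hp hq0]
    refine ListPML.le_one_sub_inv_of_forall_rat (by positivity) (by exact_mod_cast hK) fun c hrc => ?_
    have hq' := ENNReal.toReal_pos hq0 hq
    refine hc c (lt_of_le_of_lt (by positivity) hrc) ?_
    rw [div_lt_iff₀ hq'] at hrc
    rw [← ENNReal.toReal_le_toReal hp (ENNReal.mul_ne_top ENNReal.coe_ne_top hq),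
      ENNReal.toReal_mul, ENNReal.coe_toReal]
    exact hrc.le.trans (by gcongr; exact Real.le_coe_toNNReal _)
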